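/- Let $n,k$ be natural numbers. Products of permutations are read from left to right. The support of a permutation is the set of points it moves. Let $T\subset S_n$ be a set of $k$-cycles which is \emph{normal}, meaning that: (1) $T$ is \emph{split}: the supports of any two distinct elements of $T$ have at most one common point; (2) $|T|>2$ and $T$ generates $S_n$; (3) the \emph{cycle graph} $\mathrm{Cyc}(T)$ is a tree; this is the graph with vertex set $\{1,\dots,n\}$ and edges $x_1x_2,\,x_2x_3,\dots,x_{k-1}x_k$ for every cycle $(x_1\,x_2\,\dots\,x_k)\in T$, where a starting point $x_1$ has been chosen arbitrarily for each cycle of $T$; (4) every element of $T$ is adjacent to at most one leaf. Here two distinct elements of $T$ are adjacent if their supports meet, and $t\in T$ is a leaf if exactly one point of its support lies in the support of some other element of $T$. Let $\mathrm{Cay}(S_n,T)$ be the (undirected) graph with vertex set $S_n$ in which distinct $g,h$ are adjacent if and only if $gh^{-1}\in T$ or $hg^{-1}\in T$, i.e. $gh^{-1}\in T^{\pm1}:=T\cup T^{-1}$. Let $R(S_n)\le\mathrm{Aut}(\mathrm{Cay}(S_n,T))$ be the group of the translations $x\mapsto xg$ $(g\in S_n)$, and let $\mathrm{Aut}(S_n,T^{\pm1})=\{\phi\in\mathrm{Aut}(S_n)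 : \phi(T^{\pm1})=T^{\pm1}\}$, which acts on $R(S_n)$ by sending the translation by $g$ to the translation by $\phi(g)$. Then $$\mathrm{Aut}(\mathrm{Cay}(S_n,T))\;\cong\;R(S_n)\rtimes \mathrm{Aut}(S_n,T^{\pm1}),$$ by an isomorphism under which $R(S_n)$ corresponds to itself, as a subgroup of $\mathrm{Aut}(\mathrm{Cay}(S_n,T))$, and each $\phi\in\mathrm{Aut}(S_n,T^{\pm1})$ corresponds to $\phi$ itself, regarded as a permutation of the vertex set $S_n$. -/

import Mathlib

open Equiv
open scoped Pointwise

namespace SplitCycles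

section CycleSets

variable {n : ℕ}

/-- `T` is split: the supports of any two distinct elements of `T` share at most one point. -/
def IsSplit (T : Set (Perm (Fin n))) : Prop :=
  ∀ s ∈ T, ∀ t ∈ T, s ≠ t → (s.support ∩ t.support).card ≤ 1

/-- The degree of `t` in `T`: the number of points of the support of `t` that lie in the support
of some other element of `T`. -/
noncomputable def degree (T : Set (Perm (Fin n))) (t : Perm (Fin n)) : ℕ :=
  {x : Fin n | x ∈ t.support ∧ ∃ s ∈ T, s ≠ t ∧ x ∈ s.support}.ncard

/-- A leaf of `T` is an element of degree one. -/
def IsLeaf (T : Set (Perm (Fin n))) (t : Perm (Fin n)) : Prop :=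
  t ∈ T ∧ degree T t = 1

/-- Two different permutations are adjacent if their supports meet. -/
def Adjacent (s t : Perm (Fin n)) : Prop :=
  s ≠ t ∧ (s.support ∩ t.support).Nonempty

/-- The cycle graph of a set `T` of cycles, where `start t` is the point at which the notation
`t = (x₁ x₂ … x_k)` begins. The edges are `x₁x₂, …, x_{k-1}x_k`, that is, all pairs `x, t x` with
`x` in the support of `t`, except for the closing pair `x_k, x₁`, for which `t x = start t`. -/
def cycleGraph (T : Set (Perm (Fin n))) (start : Perm (Fin n) → Fin n) : SimpleGraph (Fin n) :=
  SimpleGraph.fromRel fun x y => ∃ t ∈ T, x ∈ t.support ∧ t x = y ∧ y ≠ start t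

/-- A normal set of `k`-cycles: a split set of more than two `k`-cycles that generates the
symmetric group, in which every element is adjacent to at most one leaf, and whose cycle graph
(for some choice of starting points) is a tree. -/
structure IsNormalSet (k : ℕ) (T : Set (Perm (Fin n))) : Prop where
  isCycle : ∀ t ∈ T, t.IsCycle
  length_eq : ∀ t ∈ T, t.support.card = k
  split : IsSplit T
  two_lt : 2 < T.ncard
  generates : Subgroup.closure T = ⊤
  leaf_unique : ∀ t ∈ T, ∀ l₁ l₂, IsLeaf T l₁ → IsLeaf T l₂ →
    Adjacent t l₁ → Adjacent t l₂ → l₁ = l₂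
  tree : ∃ start : Perm (Fin n) → Fin n,
    (∀ t ∈ T, start t ∈ t.support) ∧ (cycleGraph T start).IsTree

end CycleSets

section CayleyGraphs

variable {G : Type*} [Group G]

/-- The translation by `g`, as an automorphism of the Cayley graph of `G` with respect to `S`
(in which `u` and `v` are adjacent if `u⁻¹ * v ∈ S` or `v⁻¹ * u ∈ S`). -/
def translation (S : Set G) (g : G) :
    SimpleGraph.mulCayley S ≃g SimpleGraph.mulCayley S where
  toEquiv := Equiv.mulLeft g
  map_rel_iff' := by
    intro a b
    exact SimpleGraph.mulCayley_adj_mul_iff_right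

/-- The regular representation of `G` by automorphisms of its Cayley graph. -/
def regularRep (S : Set G) :
    G →* (SimpleGraph.mulCayley S ≃g SimpleGraph.mulCayley S) where
  toFun := translation S
  map_one' := by
    apply RelIso.ext
    intro x
    exact one_mul x
  map_mul' g h := by
    apply RelIso.ext
    intro x
    exact mul_assoc g h x

theorem regularRep_injective (S : Set G) : Function.Injective (regularRep S) := by
  intro g h hgh
  have key : g * 1 = h * 1 := congrArg (fun f => f (1 : G)) hgh
  simpa using key

/-- The image `R(G)` of `G` in the automorphism group of its Cayley graph. -/
def regularSubgroup (S : Set G) :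
    Subgroup (SimpleGraph.mulCayley S ≃g SimpleGraph.mulCayley S) :=
  (regularRep S).range

/-- The canonical isomorphism from `G` onto `R(G)`. -/
noncomputable def regularEquiv (S : Set G) : G ≃* regularSubgroup S :=
  MonoidHom.ofInjective (regularRep_injective S)

/-- `Aut(G, A)`: the group automorphisms of `G` that map the set `A` onto itself. -/
def autPreserving (A : Set G) : Subgroup (MulAut G) where
  carrier := {φ | φ '' A = A}
  one_mem' := by
    change (fun x : G => x) '' A = A
    simp
  mul_mem' := by
    intro φ ψ hφ hψ
    change (fun x : G => φ (ψ x)) '' A = A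
    rw [← Set.image_image φ ψ A, hψ, hφ]
  inv_mem' := by
    intro φ hφ
    change φ.symm '' A = A
    have h : φ.symm '' (φ '' A) = A := by
      rw [Set.image_image]
      simp
    rwa [hφ] at h

/-- The natural action of a group of automorphisms of `G` on `R(G)`: the automorphism `φ` maps the
translation by `g` to the translation by `φ g`. -/
noncomputable def actionOnRegular (S : Set G) (H : Subgroup (MulAut G)) :
    H →* MulAut (regularSubgroup S) :=
  (MulAut.congr (regularEquiv S)).toMonoidHom.comp H.subtype

end CayleyGraphs

end SplitCycles

/-! An automorphism `f` of the Cayley graph is studied through its edge labels: `step f g t` is the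
generator leading from `f g` to `f (g * t)`. If these labels do not depend on the base vertex `g`,
and `f 1 = 1`, then `f` is multiplicative (`PreservesSteps.map_mul`). Every automorphism is then a
translation composed with a group automorphism preserving `T ∪ T⁻¹`, which gives the semidirect
product.

The tree hypothesis enters as `SplitSystem.separated`: a product of generators supported off `t`
cannot carry one point of the support of `t` to another. Hence squares on two generators with
different supports come only from commutation (`square_cases`), so `f` preserves at each vertex the
relation "supports meet". By the leaf condition generators with different supports have different
neighbours (`not_twins`), so labels respect inverses and supports.

Independence of `g` is proved in two stages. First, the support of a label is constant
(`support_step_mul`), by incidence alone. Only the choice between a cycle and its inverse remains.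
It is settled by applying `f` to a commutator relation and following one point through the image
word (`step_mul_of_not_isPendant`, then `step_mul_of_isPendant`). -/

namespace SplitCycles

/-! ### Incidence of supports in a split system. -/

section Systems

variable {α : Type*} [Fintype α] [DecidableEq α]

/-- The supports of `s` and `t` have a common point. -/
def Meets (s t : Perm α) : Prop :=
  ∃ x, x ∈ s.support ∧ x ∈ t.support

theorem Meets.symm {s t : Perm α} (h : Meets s t) : Meets t s := by
  obtain ⟨x, hs, ht⟩ := h
  exact ⟨x, ht, hs⟩

/-- All elements of `S` whose support differs from that of `l` meet `l` in the same point. -/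
def IsPendant (S : Set (Perm α)) (l : Perm α) : Prop :=
  ∃ x, ∀ u ∈ S, u.support ≠ l.support → ∀ y ∈ u.support, y ∈ l.support → y = x

/-- The combinatorial properties of `T ∪ T⁻¹`, for a normal set `T`, that determine the
automorphisms of its Cayley graph. -/
structure SplitSystem (S : Set (Perm α)) : Prop where
  inv_mem : ∀ s ∈ S, s⁻¹ ∈ S
  isCycle : ∀ s ∈ S, s.IsCycle
  eq_or_eq_inv : ∀ s ∈ S, ∀ t ∈ S, s.support = t.support → s = t ∨ s = t⁻¹
  separated : ∀ t ∈ S, ∀ g ∈ Subgroup.closure {s ∈ S | s.support ≠ t.support},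
    ∀ x ∈ t.support, g x ∈ t.support → g x = x
  mul_self : ∀ s ∈ S, ∀ t ∈ S, s * s = 1 → t * t = 1
  closure_eq : Subgroup.closure S = ⊤
  exists_third : ∀ s ∈ S, ∀ t ∈ S, ∃ u ∈ S, u.support ≠ s.support ∧ u.support ≠ t.support
  pendant_unique : ∀ t ∈ S, ∀ l₁ ∈ S, ∀ l₂ ∈ S, IsPendant S l₁ → IsPendant S l₂ →
    t.support ≠ l₁.support → t.support ≠ l₂.support → Meets t l₁ → Meets t l₂ →
    l₁.support = l₂.support

namespace SplitSystem

variable {S : Set (Perm α)} (hS : SplitSystem S)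

include hS

theorem exists_move {s t : Perm α} (hs : s ∈ S) (hst : s.support ≠ t.support) {x y : α}
    (hx : x ∈ s.support) (hy : y ∈ s.support) :
    ∃ g ∈ Subgroup.closure {s ∈ S | s.support ≠ t.support}, g x = y := by
  obtain ⟨i, hi⟩ := (hS.isCycle s hs).exists_pow_eq (Perm.mem_support.1 hx) (Perm.mem_support.1 hy)
  exact ⟨s ^ i, pow_mem (Subgroup.subset_closure (Set.mem_sep hs hst)) i, hi⟩

/-- A power of `s` carries `x` to `y` and lies in the group that `separated` controls. The next two
lemmas compose two or three such powers along a closed chain of supports. -/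
theorem point_unique {s t : Perm α} (hs : s ∈ S) (ht : t ∈ S) (hst : s.support ≠ t.support)
    {x y : α} (hxs : x ∈ s.support) (hxt : x ∈ t.support) (hys : y ∈ s.support)
    (hyt : y ∈ t.support) : x = y := by
  obtain ⟨g, hg, rfl⟩ := hS.exists_move hs hst hxs hys
  exact (hS.separated t ht g hg x hxt hyt).symm

theorem triangle {s t u : Perm α} (hs : s ∈ S) (ht : t ∈ S) (hu : u ∈ S)
    (hts : t.support ≠ s.support) (hus : u.support ≠ s.support) {x y z : α}
    (hxs : x ∈ s.support) (hxt : x ∈ t.support) (hys : y ∈ s.support) (hyu : y ∈ u.support)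
    (hzt : z ∈ t.support) (hzu : z ∈ u.support) : x = y := by
  obtain ⟨g, hg, rfl⟩ := hS.exists_move ht hts hxt hzt
  obtain ⟨h, hh, rfl⟩ := hS.exists_move hu hus hzu hyu
  exact (hS.separated s hs (h * g) (mul_mem hh hg) x hxs hys).symm

theorem quadrangle {a b c d : Perm α} (ha : a ∈ S) (hb : b ∈ S) (hc : c ∈ S) (hd : d ∈ S)
    (hba : b.support ≠ a.support) (hca : c.support ≠ a.support) (hda : d.support ≠ a.support)
    {p q r t : α} (hpa : p ∈ a.support) (hpc : p ∈ c.support) (hrc : r ∈ c.support)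
    (hrb : r ∈ b.support) (htb : t ∈ b.support) (htd : t ∈ d.support) (hqd : q ∈ d.support)
    (hqa : q ∈ a.support) : p = q := by
  obtain ⟨g, hg, rfl⟩ := hS.exists_move hc hca hpc hrc
  obtain ⟨h, hh, rfl⟩ := hS.exists_move hb hba hrb htb
  obtain ⟨i, hi, rfl⟩ := hS.exists_move hd hda htd hqd
  exact (hS.separated a ha (i * (h * g)) (mul_mem hi (mul_mem hh hg)) p hpa hqa).symm

/-- At most one element meets both of two disjoint elements. -/
theorem support_eq_of_meets {a b c d : Perm α} (ha : a ∈ S) (hb : b ∈ S) (hc : c ∈ S) (hd : d ∈ S)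
    (hab : ¬ Meets a b) (hca : c.support ≠ a.support) (hcb : c.support ≠ b.support)
    (hda : d.support ≠ a.support) (hdb : d.support ≠ b.support)
    (hac : Meets a c) (hbc : Meets b c) (had : Meets a d) (hbd : Meets b d) :
    c.support = d.support := by
  obtain ⟨p, hpa, hpc⟩ := hac
  obtain ⟨r, hrb, hrc⟩ := hbc
  obtain ⟨q, hqa, hqd⟩ := had
  obtain ⟨t, htb, htd⟩ := hbd
  have hab' : b.support ≠ a.support := fun h => hab ⟨p, hpa, h ▸ hpa⟩
  by_contra hcd
  -- Otherwise `a`, `c`, `b`, `d` form a closed chain, so `c` and `d` share their point on `a` and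
  -- their point on `b`. Being different, they share only one point, which would lie in both `a` and
  -- `b`.
  have h₁ : p = q :=
    hS.quadrangle ha hb hc hd hab' hca hda hpa hpc hrc hrb htb htd hqd hqa
  have h₂ : r = t :=
    hS.quadrangle hb ha hc hd hab'.symm hcb hdb hrb hrc hpc hpa hqa hqd htd htb
  subst h₁ h₂
  have h₃ : p = r := hS.point_unique hc hd hcd hpc hqd hrc htd
  exact hab ⟨p, hpa, h₃ ▸ hrb⟩

/-- Otherwise `A` is invariant under the whole symmetric group, which contains `swap x z`. -/
theorem exists_leaving {A : Finset α} {x z : α} (hx : x ∈ A) (hz : z ∉ A) :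
    ∃ u ∈ S, ∃ y ∈ A, u y ∉ A := by
  by_contra! h
  have key : ∀ g : Perm α, ∀ y, y ∈ A ↔ g y ∈ A := by
    intro g
    have hg : g ∈ Subgroup.closure S := hS.closure_eq ▸ Subgroup.mem_top g
    induction hg using Subgroup.closure_induction with
    | mem u hu =>
      intro y
      refine ⟨h u hu y, fun hy => ?_⟩
      have := h u⁻¹ (hS.inv_mem u hu) _ hy
      simpa using this
    | one => simp
    | mul a b _ _ ha hb => intro y; rw [hb y, ha (b y)]; rfl
    | inv a _ ha => intro y; rw [ha (a⁻¹ y)]; simp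
  exact hz (by simpa using (key (swap x z) x).1 hx)

theorem exists_meets {s t : Perm α} (hs : s ∈ S) (ht : t ∈ S) :
    ∃ u ∈ S, u.support ≠ s.support ∧ u.support ≠ t.support ∧ (Meets u s ∨ Meets u t) := by
  obtain ⟨v, hv, hvs, hvt⟩ := hS.exists_third s hs t ht
  by_cases hm : Meets v s ∨ Meets v t
  · exact ⟨v, hv, hvs, hvt, hm⟩
  obtain ⟨z, hz, -⟩ := (hS.isCycle v hv)
  obtain ⟨x, hx, -⟩ := (hS.isCycle s hs)
  rw [← Perm.mem_support] at hz hx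
  have hzA : z ∉ s.support ∪ t.support := by
    rw [Finset.mem_union]
    rintro (h | h)
    · exact hm (Or.inl ⟨z, hz, h⟩)
    · exact hm (Or.inr ⟨z, hz, h⟩)
  obtain ⟨u, hu, y, hy, huy⟩ := hS.exists_leaving (Finset.mem_union_left _ hx) hzA
  have hyu : y ∈ u.support := by
    rw [Perm.mem_support]
    intro h
    rw [h] at huy
    exact huy hy
  have huyu : u y ∈ u.support := Perm.apply_mem_support.2 hyu
  rw [Finset.mem_union, not_or] at huy
  refine ⟨u, hu, fun h => huy.1 (h ▸ huyu), fun h => huy.2 (h ▸ huyu), ?_⟩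
  rcases Finset.mem_union.1 hy with h | h
  · exact Or.inl ⟨y, hyu, h⟩
  · exact Or.inr ⟨y, hyu, h⟩

omit hS in
theorem exists_of_not_isPendant {s : Perm α} (h : ¬ IsPendant S s) (x : α) :
    ∃ u ∈ S, u.support ≠ s.support ∧ ∃ y, y ∈ u.support ∧ y ∈ s.support ∧ y ≠ x := by
  simp only [IsPendant, not_exists, not_forall] at h
  obtain ⟨u, hu, hus, y, hyu, hys, hyx⟩ := h x
  exact ⟨u, hu, hus, y, hyu, hys, hyx⟩

/-- A non-pendant element that meets `t` also meets an element disjoint from `t`. -/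
theorem exists_disjoint {s t : Perm α} (hs : s ∈ S) (ht : t ∈ S) (hst : s.support ≠ t.support)
    (h : ¬ IsPendant S s) {x : α} (hxs : x ∈ s.support) (hxt : x ∈ t.support) :
    ∃ u ∈ S, u.support ≠ s.support ∧ ¬ Meets u t ∧ ∃ y, y ∈ u.support ∧ y ∈ s.support ∧ y ≠ x := by
  obtain ⟨u, hu, hus, y, hyu, hys, hyx⟩ := exists_of_not_isPendant h x
  refine ⟨u, hu, hus, ?_, y, hyu, hys, hyx⟩
  rintro ⟨z, hzu, hzt⟩
  exact hyx (hS.triangle hs hu ht hus hst.symm hys hyu hxs hxt hzu hzt)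

/-- A non-pendant `s` has a neighbour `u` away from its contact point with `t`, or with `c` when `s`
and `t` are disjoint. By hypothesis `u` meets `t`: this is absurd in the first case, and in the
second makes `u` and `c` two links between disjoint elements. -/
theorem isPendant_of_twin {s t c : Perm α} (hs : s ∈ S) (ht : t ∈ S) (hc : c ∈ S)
    (hst : s.support ≠ t.support)
    (h : ∀ u ∈ S, u.support ≠ s.support → u.support ≠ t.support → Meets u s → Meets u t)
    (hcs : c.support ≠ s.support) (hct : c.support ≠ t.support) (hms : Meets c s)
    (hmt : Meets c t) : IsPendant S s := by
  by_contra hp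
  obtain ⟨x, hxc, hxs⟩ := hms
  by_cases hd : Meets s t
  · obtain ⟨z, hzs, hzt⟩ := hd
    obtain ⟨u, hu, hus, hut, y, hyu, hys, hyz⟩ := hS.exists_disjoint hs ht hst hp hzs hzt
    have hut' : u.support ≠ t.support := fun e => hut ⟨y, hyu, e ▸ hyu⟩
    exact hut (h u hu hus hut' ⟨y, hyu, hys⟩)
  · obtain ⟨u, hu, hus, hut, y, hyu, hys, hyz⟩ := hS.exists_disjoint hs hc hcs.symm hp hxs hxc
    have hut' : u.support ≠ t.support := fun e => hd ⟨y, hys, e ▸ hyu⟩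
    have := hS.support_eq_of_meets hs ht hc hu hd hcs hct hus hut' ⟨x, hxs, hxc⟩ hmt.symm
      ⟨y, hys, hyu⟩ (h u hu hus hut' ⟨y, hyu, hys⟩).symm
    exact hut ⟨y, hyu, this ▸ hyu⟩

/-- Elements with different supports are met by different elements. -/
theorem not_twins {s t : Perm α} (hs : s ∈ S) (ht : t ∈ S) (hst : s.support ≠ t.support)
    (h : ∀ u ∈ S, u.support ≠ s.support → u.support ≠ t.support → (Meets u s ↔ Meets u t)) :
    False := by
  obtain ⟨c, hc, hcs, hct, hm⟩ := hS.exists_meets hs ht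
  have hmeet : Meets c s ∧ Meets c t := by
    have := h c hc hcs hct
    tauto
  refine hst (hS.pendant_unique c hc s hs t ht ?_ ?_ hcs hct hmeet.1 hmeet.2)
  · exact hS.isPendant_of_twin hs ht hc hst (fun u hu h₁ h₂ => (h u hu h₁ h₂).1) hcs hct
      hmeet.1 hmeet.2
  · exact hS.isPendant_of_twin ht hs hc hst.symm (fun u hu h₁ h₂ => (h u hu h₂ h₁).2) hct hcs
      hmeet.2 hmeet.1

end SplitSystem

end Systems

/-! ### Edge labels of a graph automorphism, and squares. -/

section Steps

variable {G : Type*} [Group G]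

/-- `1`, `s` and `t` are the vertices of a square in the Cayley graph of `S`, with `1` opposite to
the fourth vertex. -/
def SpansSquare (S : Set G) (s t : G) : Prop :=
  ∃ a ∈ S, ∃ b ∈ S, s * a = t * b ∧ s * a ≠ 1

/-- The generator that leads from `f g` to `f (g * t)`. -/
def step (f : Perm G) (g t : G) : G :=
  (f g)⁻¹ * f (g * t)

/-- `f` is an automorphism of the Cayley graph of `S = S⁻¹`. -/
def PreservesSteps (S : Set G) (f : Perm G) : Prop :=
  ∀ u v, (f u)⁻¹ * f v ∈ S ↔ u⁻¹ * v ∈ S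

theorem mul_step (f : Perm G) (g t : G) : f g * step f g t = f (g * t) := by
  simp [step]

theorem step_mul (f : Perm G) (g s t : G) :
    step f g s * step f (g * s) t = step f g (s * t) := by
  simp [step, mul_assoc]

theorem step_one (f : Perm G) (g : G) : step f g 1 = 1 := by
  simp [step]

theorem step_mul_inv (f : Perm G) (g t : G) :
    step f (g * t) t⁻¹ = (step f g t)⁻¹ := by
  simp [step]

theorem step_injective (f : Perm G) (g : G) : Function.Injective (step f g) := by
  intro s t h
  simpa [step] using h

namespace PreservesSteps

variable {S : Set G} {f : Perm G} (hf : PreservesSteps S f)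

include hf

theorem step_mem {g t : G} : step f g t ∈ S ↔ t ∈ S := by
  rw [step, hf, inv_mul_cancel_left]

theorem exists_step_eq (g : G) {t : G} (ht : t ∈ S) : ∃ s ∈ S, step f g s = t := by
  have h : step f g (g⁻¹ * f.symm (f g * t)) = t := by simp [step]
  exact ⟨_, (hf.step_mem (g := g)).1 (h.symm ▸ ht), h⟩

theorem spansSquare_iff (g s t : G) :
    SpansSquare S (step f g s) (step f g t) ↔ SpansSquare S s t := by
  constructor
  · rintro ⟨a, ha, b, hb, h, h1⟩
    obtain ⟨a, ha', rfl⟩ := hf.exists_step_eq (g * s) ha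
    obtain ⟨b, hb', rfl⟩ := hf.exists_step_eq (g * t) hb
    rw [step_mul] at h h1
    rw [step_mul] at h
    refine ⟨a, ha', b, hb', step_injective f g h, fun e => h1 ?_⟩
    rw [e, step_one]
  · rintro ⟨a, ha, b, hb, h, h1⟩
    refine ⟨step f (g * s) a, hf.step_mem.2 ha, step f (g * t) b, hf.step_mem.2 hb, ?_, ?_⟩
    · rw [step_mul, step_mul, h]
    · rw [step_mul]
      intro e
      rw [← step_one f g] at e
      exact h1 (step_injective f g e)

end PreservesSteps

end Steps

/-! ### Squares detect disjointness; supports of labels are constant. -/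

section SplitSystems

variable {α : Type*} [Fintype α] [DecidableEq α]

theorem not_meets_iff_disjoint {s t : Perm α} : ¬ Meets s t ↔ Perm.Disjoint s t := by
  rw [Perm.disjoint_iff_disjoint_support, Finset.disjoint_left]
  simp [Meets]

theorem apply_of_not_meets {s t : Perm α} (h : ¬ Meets s t) {x : α} (hx : x ∈ t.support) :
    s x = x := by
  by_contra hsx
  exact h ⟨x, Perm.mem_support.2 hsx, hx⟩

namespace SplitSystem

variable {S : Set (Perm α)} (hS : SplitSystem S)

include hS

theorem exists_mem_support {s : Perm α} (hs : s ∈ S) : ∃ x, x ∈ s.support := by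
  obtain ⟨x, hx, -⟩ := hS.isCycle s hs
  exact ⟨x, Perm.mem_support.2 hx⟩

theorem notMem_closure {s : Perm α} (hs : s ∈ S) :
    s ∉ Subgroup.closure {u ∈ S | u.support ≠ s.support} := by
  intro h
  obtain ⟨x, hx⟩ := hS.exists_mem_support hs
  exact Perm.mem_support.1 hx (hS.separated s hs s h x hx (Perm.apply_mem_support.2 hx))

/-- The only squares through two elements with different supports come from commutation. -/
theorem square_cases {s t a b : Perm α} (hs : s ∈ S) (ht : t ∈ S) (ha : a ∈ S) (hb : b ∈ S)
    (hst : s.support ≠ t.support) (h : s * a = t * b) (h1 : s * a ≠ 1) :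
    ¬ Meets s t ∧ a = t ∧ b = s := by
  -- If `b` were supported off `s`, then `t * b` would lie in the group separated from `s`, and so
  -- would `s * s` or `s` itself.
  have side : ∀ {s t a b : Perm α}, s ∈ S → t ∈ S → a ∈ S → b ∈ S → s.support ≠ t.support →
      s * a = t * b → s * a ≠ 1 → b.support = s.support := by
    intro s t a b hs ht ha hb hst h h1
    by_contra hbs
    have htb : t * b ∈ Subgroup.closure {u ∈ S | u.support ≠ s.support} :=
      mul_mem (Subgroup.subset_closure (Set.mem_sep ht hst.symm))
        (Subgroup.subset_closure (Set.mem_sep hb hbs))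
    by_cases has : a.support = s.support
    · rcases hS.eq_or_eq_inv a ha s hs has with rfl | rfl
      · obtain ⟨x, hx⟩ : ∃ x, (a * a) x ≠ x := by
          by_contra! hx
          exact h1 (Equiv.ext hx)
        have hxa : x ∈ a.support := by
          rw [Perm.mem_support]
          intro e
          exact hx (by simp [e])
        refine hx (hS.separated a ha (a * a) (h ▸ htb) x hxa ?_)
        exact Perm.apply_mem_support.2 (Perm.apply_mem_support.2 hxa)
      · simp at h1
    · refine hS.notMem_closure hs ?_
      have e : s = t * b * a⁻¹ := eq_mul_inv_of_mul_eq h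
      have ha' : a ∈ Subgroup.closure {u ∈ S | u.support ≠ s.support} :=
        Subgroup.subset_closure (Set.mem_sep ha has)
      have := mul_mem htb (Subgroup.inv_mem _ ha')
      rwa [← e] at this
  have hbs := side hs ht ha hb hst h h1
  have hat := side ht hs hb ha hst.symm h.symm (h ▸ h1)
  have hd : ¬ Meets s t := by
    -- At the point `a⁻¹ x`, which `b` fixes, the relation puts `s x` in the support of `t`: a
    -- second common point.
    rintro ⟨x, hxs, hxt⟩
    have hpt : a⁻¹ x ∈ t.support := by
      rw [← hat, ← Perm.support_inv, Perm.apply_mem_support, Perm.support_inv, hat]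
      exact hxt
    have hps : a⁻¹ x ∉ s.support := by
      intro hps
      have e := hS.point_unique hs ht hst hps hpt hxs hxt
      rw [Perm.inv_eq_iff_eq] at e
      rw [← hat, Perm.mem_support] at hxt
      exact hxt e.symm
    have hpb : b (a⁻¹ x) = a⁻¹ x := by
      rw [← hbs] at hps
      exact Perm.notMem_support.1 hps
    have e := congrArg (fun g : Perm α => g (a⁻¹ x)) h
    simp only [Perm.mul_apply, hpb] at e
    rw [show a (a⁻¹ x) = x by simp] at e
    have hsx : s x ∈ t.support := by
      rw [e]
      exact Perm.apply_mem_support.2 hpt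
    exact Perm.mem_support.1 hxs
      (hS.point_unique hs ht hst (Perm.apply_mem_support.2 hxs) hsx hxs hxt)
  have hb' : b = s := by
    ext x
    by_cases hx : x ∈ s.support
    · have hax : a x = x := by
        rw [← Perm.notMem_support, hat]
        exact fun hxt => hd ⟨x, hx, hxt⟩
      have e := congrArg (fun g : Perm α => g x) h
      simp only [Perm.mul_apply, hax] at e
      have hbx : b x ∈ s.support := by
        rw [← hbs] at hx ⊢
        exact Perm.apply_mem_support.2 hx
      rw [apply_of_not_meets (fun h => hd h.symm) hbx] at e
      exact e.symm
    · rw [Perm.notMem_support.1 hx]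
      rw [← hbs] at hx
      exact Perm.notMem_support.1 hx
  refine ⟨hd, ?_, hb'⟩
  rw [hb', ← (not_meets_iff_disjoint.1 hd).commute.eq] at h
  exact mul_left_cancel h

theorem spansSquare_iff {s t : Perm α} (hs : s ∈ S) (ht : t ∈ S) (hst : s.support ≠ t.support) :
    SpansSquare S s t ↔ ¬ Meets s t := by
  constructor
  · rintro ⟨a, ha, b, hb, h, h1⟩
    exact (hS.square_cases hs ht ha hb hst h h1).1
  · intro h
    refine ⟨t, ht, s, hs, (not_meets_iff_disjoint.1 h).commute.eq, fun e => hst ?_⟩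
    rw [eq_inv_of_mul_eq_one_left e, Perm.support_inv]

theorem support_eq_iff {s t : Perm α} (hs : s ∈ S) (ht : t ∈ S) :
    s.support = t.support ↔ s = t ∨ s = t⁻¹ := by
  refine ⟨hS.eq_or_eq_inv s hs t ht, ?_⟩
  rintro (rfl | rfl)
  · rfl
  · exact Perm.support_inv t

end SplitSystem

namespace PreservesSteps

variable {S : Set (Perm α)} {f : Perm (Perm α)} (hf : PreservesSteps S f)

include hf

variable (hS : SplitSystem S)

include hS

/-- `t` and `t⁻¹` meet the same generators, and squares transport this to their labels; `not_twins`
then applies. -/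
theorem support_step_inv (g : Perm α) {t : Perm α} (ht : t ∈ S) :
    (step f g t⁻¹).support = (step f g t).support := by
  by_contra hne
  refine hS.not_twins (hf.step_mem.2 (hS.inv_mem t ht)) (hf.step_mem.2 ht) hne ?_
  intro u hu h₁ h₂
  obtain ⟨u, hu', rfl⟩ := hf.exists_step_eq g hu
  have hut : u.support ≠ t.support := by
    intro e
    rcases hS.eq_or_eq_inv u hu' t ht e with rfl | rfl
    · exact h₂ rfl
    · exact h₁ rfl
  have hut' : u.support ≠ (t⁻¹).support := by rwa [Perm.support_inv]
  rw [← not_iff_not, ← hS.spansSquare_iff hu (hf.step_mem.2 ht) h₂,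
    ← hS.spansSquare_iff hu (hf.step_mem.2 (hS.inv_mem t ht)) h₁, hf.spansSquare_iff,
    hf.spansSquare_iff, hS.spansSquare_iff hu' ht hut,
    hS.spansSquare_iff hu' (hS.inv_mem t ht) hut']
  simp [Meets]

theorem step_inv (g : Perm α) {t : Perm α} (ht : t ∈ S) :
    step f g t⁻¹ = (step f g t)⁻¹ := by
  rcases hS.eq_or_eq_inv _ (hf.step_mem.2 (hS.inv_mem t ht)) _ (hf.step_mem.2 ht)
    (hf.support_step_inv hS g ht) with h | h
  · rw [h]
    -- Equal labels force `t = t⁻¹`; all generators are then involutions.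
    have htt : t * t = 1 := by
      rw [← inv_eq_iff_mul_eq_one]
      exact step_injective f g h
    rw [eq_comm, inv_eq_iff_mul_eq_one]
    exact hS.mul_self t ht _ (hf.step_mem.2 ht) htt
  · exact h

theorem support_step_eq_iff (g : Perm α) {s t : Perm α} (hs : s ∈ S) (ht : t ∈ S) :
    (step f g s).support = (step f g t).support ↔ s.support = t.support := by
  rw [hS.support_eq_iff hs ht, hS.support_eq_iff (hf.step_mem.2 hs) (hf.step_mem.2 ht),
    ← hf.step_inv hS g ht, (step_injective f g).eq_iff, (step_injective f g).eq_iff]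

theorem meets_step_iff (g : Perm α) {s t : Perm α} (hs : s ∈ S) (ht : t ∈ S) :
    Meets (step f g s) (step f g t) ↔ Meets s t := by
  by_cases hst : s.support = t.support
  · have h := (hf.support_step_eq_iff hS g hs ht).2 hst
    obtain ⟨x, hx⟩ := hS.exists_mem_support hs
    obtain ⟨y, hy⟩ := hS.exists_mem_support ((hf.step_mem (g := g)).2 hs)
    exact iff_of_true ⟨y, hy, h ▸ hy⟩ ⟨x, hx, hst ▸ hx⟩
  · rw [← not_iff_not, ← hS.spansSquare_iff hs ht hst, ← hS.spansSquare_iff (hf.step_mem.2 hs)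
      (hf.step_mem.2 ht) (mt (hf.support_step_eq_iff hS g hs ht).1 hst), hf.spansSquare_iff]

/-- The commuting square on `s` and `t` maps to a square, again a commuting one, whose opposite
sides carry equal labels. -/
theorem step_mul_of_not_meets (g : Perm α) {s t : Perm α} (hs : s ∈ S) (ht : t ∈ S)
    (h : ¬ Meets s t) : step f (g * t) s = step f g s := by
  have hst : s.support ≠ t.support := by
    intro e
    obtain ⟨x, hx⟩ := hS.exists_mem_support hs
    exact h ⟨x, hx, e ▸ hx⟩
  have hcomm := (not_meets_iff_disjoint.1 h).commute.eq
  refine (hS.square_cases (hf.step_mem (g := g).2 hs) (hf.step_mem (g := g).2 ht)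
    (hf.step_mem (g := g * s).2 ht) (hf.step_mem (g := g * t).2 hs)
    (mt (hf.support_step_eq_iff hS g hs ht).1 hst) ?_ ?_).2.2
  · rw [step_mul, step_mul, hcomm]
  · rw [step_mul, ← step_one f g, (step_injective f g).ne_iff]
    intro e
    rw [eq_inv_of_mul_eq_one_left e, Perm.support_inv] at hst
    exact hst rfl

theorem step_mul_self (g : Perm α) {t : Perm α} (ht : t ∈ S) :
    step f (g * t) t = step f g t := by
  have h := step_mul_inv f g t
  rwa [hf.step_inv hS _ ht, inv_inj] at h

/-- In the main case `s` links `t` to some `u` disjoint from `t`. The labels of `t` and `u` agree at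
`g` and `g * t`, and only one support links two disjoint elements. -/
theorem support_step_mul_of_not_isPendant (g : Perm α) {s t : Perm α} (hs : s ∈ S) (ht : t ∈ S)
    (hp : ¬ IsPendant S s) : (step f (g * t) s).support = (step f g s).support := by
  by_cases hst : s.support = t.support
  · rcases hS.eq_or_eq_inv t ht s hs hst.symm with rfl | rfl
    · rw [hf.step_mul_self hS g hs]
    · have := hf.step_mul_self hS g ht
      rw [hf.step_inv hS _ hs, hf.step_inv hS _ hs, inv_inj] at this
      rw [this]
  by_cases hm : Meets s t
  swap
  · rw [hf.step_mul_of_not_meets hS g hs ht hm]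
  obtain ⟨x, hxs, hxt⟩ := hm
  obtain ⟨u, hu, hus, hut, y, hyu, hys, -⟩ := hS.exists_disjoint hs ht hst hp hxs hxt
  have et := hf.step_mul_self hS g ht
  have eu := hf.step_mul_of_not_meets hS g hu ht hut
  refine hS.support_eq_of_meets (hf.step_mem (g := g).2 ht) (hf.step_mem (g := g).2 hu)
    (hf.step_mem.2 hs) (hf.step_mem.2 hs) ?_ ?_ ?_ ?_ ?_ ?_ ?_ ?_ ?_
  · rw [hf.meets_step_iff hS g ht hu]
    exact fun h => hut h.symm
  · rw [← et, Ne, hf.support_step_eq_iff hS _ hs ht]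
    exact hst
  · rw [← eu, Ne, hf.support_step_eq_iff hS _ hs hu]
    exact hus.symm
  · rw [Ne, hf.support_step_eq_iff hS _ hs ht]
    exact hst
  · rw [Ne, hf.support_step_eq_iff hS _ hs hu]
    exact hus.symm
  · rw [← et, hf.meets_step_iff hS _ ht hs]
    exact ⟨x, hxt, hxs⟩
  · rw [← eu, hf.meets_step_iff hS _ hu hs]
    exact ⟨y, hyu, hys⟩
  · rw [hf.meets_step_iff hS _ ht hs]
    exact ⟨x, hxt, hxs⟩
  · rw [hf.meets_step_iff hS _ hu hs]
    exact ⟨y, hyu, hys⟩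

theorem support_step_mul (g : Perm α) {s t : Perm α} (hs : s ∈ S) (ht : t ∈ S) :
    (step f (g * t) s).support = (step f g s).support := by
  by_cases hp : IsPendant S s
  swap
  · exact hf.support_step_mul_of_not_isPendant hS g hs ht hp
  by_cases hm : Meets s t
  swap
  · rw [hf.step_mul_of_not_meets hS g hs ht hm]
  by_cases hst : s.support = t.support
  · rcases hS.eq_or_eq_inv s hs t ht hst with rfl | rfl
    · rw [hf.step_mul_self hS g hs]
    · rw [hf.step_inv hS _ ht, hf.step_inv hS _ ht, Perm.support_inv, Perm.support_inv,
        hf.step_mul_self hS g ht]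
  obtain ⟨r, hr, hrs⟩ := hf.exists_step_eq g (hf.step_mem (g := g * t).2 hs)
  have et := hf.step_mul_self hS g ht
  have hrt : r.support ≠ t.support := by
    rw [Ne, ← hf.support_step_eq_iff hS g hr ht, hrs, ← et, hf.support_step_eq_iff hS _ hs ht]
    exact hst
  have hmr : Meets r t := by
    rwa [← hf.meets_step_iff hS g hr ht, hrs, ← et, hf.meets_step_iff hS _ hs ht]
  rw [← hrs, hf.support_step_eq_iff hS g hr hs]
  by_contra hne
  -- `r` and `s` both meet `t`, which has at most one pendant neighbour. So `r` keeps its support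
  -- from `g` to `g * t`, where it collides with `s`.
  have hpr : ¬ IsPendant S r := fun h =>
    hne (hS.pendant_unique t ht r hr s hs h hp hrt.symm (fun e => hst e.symm) hmr.symm hm.symm)
  have h := hf.support_step_mul_of_not_isPendant hS g hr ht hpr
  rw [hrs, hf.support_step_eq_iff hS _ hr hs] at h
  exact hne h

end PreservesSteps

end SplitSystems

/-! ### Words in elements with constant labels. -/

section Steps

variable {G : Type*} [Group G]

theorem step_conj (f : Perm G) {v w : G}
    (hv : ∀ g, step f g v = step f 1 v) (hw : ∀ g, step f g w = step f 1 w) (g : G) :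
    step f g (v * w * v⁻¹) = step f 1 v * step f 1 w * (step f 1 v)⁻¹ := by
  have h := step_mul_inv f (g * (v * w) * v⁻¹) v
  rw [inv_mul_cancel_right, hv] at h
  rw [← step_mul, ← step_mul, hv g, hw, h]

theorem step_inv_of_forall (f : Perm G) {v : G}
    (hv : ∀ g, step f g v = step f 1 v) (g : G) : step f g v⁻¹ = (step f 1 v)⁻¹ := by
  have h := step_mul_inv f (g * v⁻¹) v
  rwa [inv_mul_cancel_right, hv] at h

theorem step_pow_of_forall (f : Perm G) {v : G}
    (hv : ∀ g, step f g v = step f 1 v) (i : ℕ) (g : G) :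
    step f g (v ^ i) = step f 1 v ^ i := by
  induction i with
  | zero => simp [step_one]
  | succ i ih => rw [pow_succ, ← step_mul, ih, hv (g * v ^ i), pow_succ]

end Steps

/-! ### Following a point through a word. -/

section Words

variable {α : Type*} [Fintype α] [DecidableEq α]

theorem mem_support_conj {σ τ : Perm α} {x : α} :
    x ∈ (σ * τ * σ⁻¹).support ↔ σ⁻¹ x ∈ τ.support := by
  rw [Perm.mem_support, Perm.mem_support, Perm.mul_apply, Perm.mul_apply, Ne, Ne,
    Perm.eq_inv_iff_eq]

theorem inv_apply_mem_support {σ : Perm α} {x : α} : σ⁻¹ x ∈ σ.support ↔ x ∈ σ.support := by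
  rw [← Perm.support_inv, Perm.apply_mem_support]

/-- With `w = t₀⁻¹ (s (t₁ y))`, the relation sends `w` to `y` under `u₁ * c * u₂`, and this puts `w`
in the support of `u₁`. Were `t₁ y` moved by `s`, `w` would be common to `s` and `u₁`; so `w = t₀⁻¹
(t₁ y)` lies on both `t₁` and `u₁`, hence is `y`. -/
theorem apply_eq_of_pinned_word {s t₀ t₁ u₁ u₂ c : Perm α} {y : α} (hyt : y ∈ t₁.support)
    (hyu : y ∈ u₁.support) (hu : u₂.support = u₁.support) (ht : t₀.support = t₁.support)
    (hsu : ¬ Meets s u₁) (htu : ∀ z ∈ t₁.support, z ∈ u₁.support → z = y)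
    (hst : ∀ z ∈ s.support, z ∈ t₁.support → ∀ w ∈ s.support, w ∈ t₁.support → z = w)
    (hc : ∀ z ∈ u₁.support, z ≠ y → c z = z)
    (h : s * t₁ * u₁ * c * u₂ * t₀⁻¹ = 1) : t₁ y = t₀ y := by
  set w := t₀⁻¹ (s (t₁ y)) with hw
  have h₁ : u₁ (c (u₂ w)) = y := by
    have h' : t₀⁻¹ * (s * t₁ * u₁ * c * u₂ * t₀⁻¹) * t₀ * (t₀⁻¹ * s * t₁) =
        t₀⁻¹ * 1 * t₀ * (t₀⁻¹ * s * t₁) := by rw [h]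
    have h'' : u₁ * c * u₂ * (t₀⁻¹ * s * t₁) = 1 := by
      have : t₀⁻¹ * s * t₁ * (u₁ * c * u₂ * (t₀⁻¹ * s * t₁)) = t₀⁻¹ * s * t₁ := by
        simpa [mul_assoc] using h'
      simpa using this
    have := congrArg (fun g : Perm α => g y) h''
    simpa [hw, Perm.mul_apply] using this
  have hq : u₁⁻¹ y ∈ u₁.support := inv_apply_mem_support.2 hyu
  have hqy : u₁⁻¹ y ≠ y := by
    rw [Ne, Perm.inv_eq_iff_eq]
    exact fun e => Perm.mem_support.1 hyu e.symm
  have h₂ : c (u₂ w) = u₁⁻¹ y := by rw [Perm.eq_inv_iff_eq, h₁]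
  rw [← hc _ hq hqy] at h₂
  have h₃ : u₂ w = u₁⁻¹ y := c.injective h₂
  have hwu : w ∈ u₁.support := by
    rw [← hu, ← Perm.apply_mem_support, h₃, hu]
    exact hq
  have hty : t₁ y ∈ t₁.support := Perm.apply_mem_support.2 hyt
  by_cases hp : t₁ y ∈ s.support
  · have hsp : s (t₁ y) ∈ s.support := Perm.apply_mem_support.2 hp
    have hst' : s (t₁ y) ∉ t₁.support := fun hm =>
      Perm.mem_support.1 hp (hst _ hsp hm _ hp hty)
    have hws : w = s (t₁ y) := by
      rw [hw, ← Perm.notMem_support, Perm.support_inv, ht]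
      exact hst'
    exact absurd ⟨w, hws ▸ hsp, hwu⟩ hsu
  · rw [Perm.notMem_support.1 hp] at hw
    have hwt : w ∈ t₁.support := by
      rw [hw, ← ht, inv_apply_mem_support, ht]
      exact hty
    rw [htu w hwt hwu, Perm.eq_inv_iff_eq] at hw
    exact hw.symm

theorem apply_apply_eq_of_fixed {s₁ s₂ t : Perm α} {x z : α} (hs : s₂.support = s₁.support)
    (hxs : x ∈ s₁.support) (hst : ∀ w ∈ s₁.support, w ∈ t.support → w = x)
    (hzt : z ∈ t.support) (h : s₁ (t (s₂ z)) = z) : s₁ (s₂ x) = x := by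
  by_cases hzx : z = x
  · subst hzx
    have hsz : s₂ z ∈ s₁.support := by
      rw [← hs] at hxs ⊢
      exact Perm.apply_mem_support.2 hxs
    have hne : s₂ z ≠ z := by
      rw [← hs] at hxs
      exact Perm.mem_support.1 hxs
    have htz : s₂ z ∉ t.support := fun hm => hne (hst _ hsz hm)
    rwa [Perm.notMem_support.1 htz] at h
  · have hzs : z ∉ s₁.support := fun hm => hzx (hst _ hm hzt)
    have hzs' : s₂ z = z := by
      rw [← hs] at hzs
      exact Perm.notMem_support.1 hzs
    rw [hzs'] at h
    by_cases hm : t z ∈ s₁.support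
    · have := Perm.apply_mem_support.2 hm
      rw [h] at this
      exact absurd this hzs
    · rw [Perm.notMem_support.1 hm] at h
      exact absurd h (Perm.mem_support.1 hzt)

end Words

/-! ### Labels do not depend on the base vertex. -/

section Rigidity

variable {α : Type*} [Fintype α] [DecidableEq α]

namespace SplitSystem

variable {S : Set (Perm α)} (hS : SplitSystem S)

include hS

theorem apply_eq_apply_one {β : Type*} {F : Perm α → β} (h : ∀ s ∈ S, ∀ g, F (g * s) = F g)
    (g : Perm α) : F g = F 1 := by
  have key : ∀ k h, F (h * k) = F h := by
    intro k
    have hk : k ∈ Subgroup.closure S := hS.closure_eq ▸ Subgroup.mem_top k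
    induction hk using Subgroup.closure_induction with
    | mem s hs => exact h s hs
    | one => simp
    | mul a b _ _ ha hb => intro g; rw [← mul_assoc, hb, ha]
    | inv a _ ha => intro g; rw [← ha, inv_mul_cancel_right]
  simpa using key g 1

theorem eq_of_apply_eq {s t : Perm α} (hs : s ∈ S) (ht : t ∈ S) (hst : s.support = t.support)
    {y : α} (hy : y ∈ t.support) (h : s y = t y) : s = t := by
  rcases hS.eq_or_eq_inv s hs t ht hst with rfl | rfl
  · rfl
  · rw [inv_eq_iff_mul_eq_one, ← sq, (hS.isCycle t ht).pow_eq_one_iff]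
    refine ⟨y, Perm.mem_support.1 hy, ?_⟩
    rw [sq, Perm.mul_apply, ← h]
    simp

/-- If both were pendant, any third element meeting one would do so at their common point. It would
have two pendant neighbours. -/
theorem not_isPendant_of_meets {s t : Perm α} (hs : s ∈ S) (ht : t ∈ S)
    (hst : s.support ≠ t.support) (hm : Meets s t) (hp : IsPendant S s) : ¬ IsPendant S t := by
  intro hq
  obtain ⟨x, hxs, hxt⟩ := hm
  obtain ⟨u, hu, hus, hut, hm⟩ := hS.exists_meets hs ht
  have key : Meets u s ∧ Meets u t := by
    obtain ⟨a, ha⟩ := id hp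
    obtain ⟨b, hb⟩ := id hq
    rcases hm with ⟨z, hzu, hzs⟩ | ⟨z, hzu, hzt⟩
    · have e : z = x := (ha u hu hus z hzu hzs).trans (ha t ht hst.symm x hxt hxs).symm
      exact ⟨⟨z, hzu, hzs⟩, ⟨z, hzu, e ▸ hxt⟩⟩
    · have e : z = x := (hb u hu hut z hzu hzt).trans (hb s hs hst x hxs hxt).symm
      exact ⟨⟨z, hzu, e ▸ hxs⟩, ⟨z, hzu, hzt⟩⟩
  exact hst (hS.pendant_unique u hu s hs t ht hp hq hus hut key.1 key.2)

end SplitSystem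

namespace PreservesSteps

variable {S : Set (Perm α)} {f : Perm (Perm α)} (hf : PreservesSteps S f) (hS : SplitSystem S)

include hf hS

theorem support_step_eq (g h : Perm α) {s : Perm α} (hs : s ∈ S) :
    (step f g s).support = (step f h s).support := by
  have key := hS.apply_eq_apply_one (F := fun g => (step f g s).support)
    fun t ht g => hf.support_step_mul hS g hs ht
  exact (key g).trans (key h).symm

theorem support_step_inv_eq (g h : Perm α) {s : Perm α} (hs : s ∈ S) :
    (step f g s⁻¹).support = (step f h s).support := by
  rw [hf.step_inv hS g hs, Perm.support_inv, hf.support_step_eq hS g h hs]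

theorem step_mul_of_support_eq (g : Perm α) {s t : Perm α} (hs : s ∈ S) (ht : t ∈ S)
    (hst : s.support = t.support) : step f (g * t) s = step f g s := by
  rcases hS.eq_or_eq_inv s hs t ht hst with rfl | rfl
  · rw [hf.step_mul_self hS g hs]
  · rw [hf.step_inv hS _ ht, hf.step_inv hS _ ht, hf.step_mul_self hS g ht]

/-- Conjugation by `t` moves the contact point of `u` from `y` to `t y ≠ x`, so `s` commutes with `t
* u * t⁻¹`. The image of this relation determines the label of `t` at one moved point, which fixes
its direction. -/
theorem step_mul_of_apply_ne (g : Perm α) {s t u : Perm α} (hs : s ∈ S) (ht : t ∈ S) (hu : u ∈ S)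
    (hst : s.support ≠ t.support) (hut : u.support ≠ t.support) (hus : ¬ Meets u s) {x y : α}
    (hxs : x ∈ s.support) (hxt : x ∈ t.support) (hyu : y ∈ u.support) (hyt : y ∈ t.support)
    (hne : t y ≠ x) : step f (g * s) t = step f g t := by
  have hd : ¬ Meets s (t * u * t⁻¹) := by
    rintro ⟨p, hps, hp⟩
    rw [mem_support_conj] at hp
    by_cases hpt : t⁻¹ p ∈ t.support
    · have e := hS.point_unique hu ht hut hyu hyt hp hpt
      rw [Perm.eq_inv_iff_eq] at e
      rw [inv_apply_mem_support] at hpt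
      exact hne (e.trans (hS.point_unique hs ht hst hps hpt hxs hxt))
    · rw [inv_apply_mem_support] at hpt
      have e : t⁻¹ p = p := by rwa [← Perm.notMem_support, Perm.support_inv]
      exact hus ⟨p, e ▸ hp, hps⟩
  have hcomm := (not_meets_iff_disjoint.1 hd).commute.eq
  have hrel : s * t * u * (t⁻¹ * s⁻¹ * t) * u⁻¹ = t := by
    have : s * (t * u * t⁻¹) * s⁻¹ * (t * u⁻¹) = t := by
      rw [hcomm]
      simp [mul_assoc]
    simpa [mul_assoc] using this
  have hprod : step f g s * step f (g * s) t * step f (g * s * t) u *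
      (step f (g * s * t * u) t⁻¹ * step f (g * s * t * u * t⁻¹) s⁻¹ *
        step f (g * s * t * u * t⁻¹ * s⁻¹) t) * step f (g * s * t * u * t⁻¹ * s⁻¹ * t) u⁻¹ =
      step f g t := by
    have e := congrArg (step f g) hrel
    simp only [← step_mul, ← mul_assoc] at e
    simpa only [← mul_assoc] using e
  obtain ⟨y', hyu', hyt'⟩ := (hf.meets_step_iff hS g hu ht).2 ⟨y, hyu, hyt⟩
  have hus' := mt (hf.meets_step_iff hS g hu hs).1 hus
  have hut' := mt (hf.support_step_eq_iff hS g hu ht).1 hut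
  have hst' := mt (hf.support_step_eq_iff hS g hs ht).1 hst
  have ms := hf.step_mem (g := g).2 hs
  have mt := hf.step_mem (g := g).2 ht
  have mu := hf.step_mem (g := g).2 hu
  have et := hf.support_step_eq hS (g * s) g ht
  have eu := hf.support_step_eq hS (g * s * t) g hu
  refine hS.eq_of_apply_eq (hf.step_mem.2 ht) mt et hyt'
    (apply_eq_of_pinned_word (s := step f g s) (u₁ := step f (g * s * t) u)
      (u₂ := step f (g * s * t * u * t⁻¹ * s⁻¹ * t) u⁻¹) (c := step f (g * s * t * u) t⁻¹ *
        step f (g * s * t * u * t⁻¹) s⁻¹ * step f (g * s * t * u * t⁻¹ * s⁻¹) t)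
      (et ▸ hyt') (eu ▸ hyu') ?_ et.symm ?_ ?_ ?_ ?_ (by rw [hprod, mul_inv_cancel]))
  · exact hf.support_step_inv_eq hS _ _ hu
  · rintro ⟨z, h₁, h₂⟩
    exact hus' ⟨z, eu ▸ h₂, h₁⟩
  · intro z h₁ h₂
    exact hS.point_unique mu mt hut' (eu ▸ h₂) (et ▸ h₁) hyu' hyt'
  · intro z h₁ h₂ w h₃ h₄
    exact hS.point_unique ms mt hst' h₁ (et ▸ h₂) h₃ (et ▸ h₄)
  · intro z hz hzy
    rw [eu] at hz
    have hzt : z ∉ (step f g t).support := fun hm =>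
      hzy (hS.point_unique mu mt hut' hz hm hyu' hyt')
    have hzs : z ∉ (step f g s).support := fun hm => hus' ⟨z, hz, hm⟩
    have h₁ : step f (g * s * t * u * t⁻¹ * s⁻¹) t z = z := by
      rwa [← Perm.notMem_support, hf.support_step_eq hS _ g ht]
    have h₂ : step f (g * s * t * u * t⁻¹) s⁻¹ z = z := by
      rwa [← Perm.notMem_support, hf.support_step_inv_eq hS _ g hs]
    have h₃ : step f (g * s * t * u) t⁻¹ z = z := by
      rwa [← Perm.notMem_support, hf.support_step_inv_eq hS _ g ht]
    rw [Perm.mul_apply, Perm.mul_apply, h₁, h₂, h₃]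

theorem step_mul_of_not_isPendant (g : Perm α) {s t : Perm α} (hs : s ∈ S) (ht : t ∈ S)
    (hp : ¬ IsPendant S t) : step f (g * s) t = step f g t := by
  by_cases hst : s.support = t.support
  · exact hf.step_mul_of_support_eq hS g ht hs hst.symm
  by_cases hm : Meets t s
  swap
  · exact hf.step_mul_of_not_meets hS g ht hs hm
  obtain ⟨x, hxt, hxs⟩ := hm
  obtain ⟨u, hu, hut, hus, y, hyu, hyt, -⟩ := hS.exists_disjoint ht hs (Ne.symm hst) hp hxt hxs
  by_cases hy : t y = x
  swap
  · exact hf.step_mul_of_apply_ne hS g hs ht hu hst hut hus hxs hxt hyu hyt hy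
  -- If `t y = x`, the inverse `t⁻¹` can be used instead, unless `t⁻¹ y = x` too; then `t` is an
  -- involution and has no direction to determine.
  by_cases hy' : t⁻¹ y = x
  · have htt : t⁻¹ = t :=
      hS.eq_of_apply_eq (hS.inv_mem t ht) ht (Perm.support_inv t) hyt (hy'.trans hy.symm)
    rcases hS.eq_or_eq_inv _ (hf.step_mem.2 ht) _ (hf.step_mem.2 ht)
      (hf.support_step_mul hS g ht hs) with h | h
    · exact h
    · rw [h, ← hf.step_inv hS g ht, htt]
  · have h := hf.step_mul_of_apply_ne hS g hs (hS.inv_mem t ht) hu (by rwa [Perm.support_inv])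
      (by rwa [Perm.support_inv]) hus hxs (by rwa [Perm.support_inv]) hyu
      (by rwa [Perm.support_inv]) hy'
    rwa [hf.step_inv hS _ ht, hf.step_inv hS _ ht, inv_inj] at h

/-- A pendant `s` has no second contact point, so the relation used is different: `u`, another
neighbour of `t`, is slid along `t` to the contact point `x` of `s`. Conjugation by `s` takes `t`
off `x`, so `s * t * s⁻¹` commutes with the slid copy. The labels of `t` and `u` are already
constant, both being non-pendant. -/
theorem step_mul_of_isPendant (g : Perm α) {s t : Perm α} (hs : s ∈ S) (ht : t ∈ S)
    (hp : IsPendant S s) : step f (g * t) s = step f g s := by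
  by_cases hst : s.support = t.support
  · exact hf.step_mul_of_support_eq hS g hs ht hst
  by_cases hm : Meets s t
  swap
  · exact hf.step_mul_of_not_meets hS g hs ht hm
  have hpt := hS.not_isPendant_of_meets hs ht hst hm hp
  obtain ⟨x, hxs, hxt⟩ := hm
  obtain ⟨u, hu, hut, hus, y, hyu, hyt, -⟩ := hS.exists_disjoint ht hs (Ne.symm hst) hpt hxt hxs
  have hpu : ¬ IsPendant S u := by
    intro h
    have e := hS.pendant_unique t ht u hu s hs h hp hut.symm (Ne.symm hst) ⟨y, hyt, hyu⟩
      ⟨x, hxt, hxs⟩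
    exact hus ⟨y, hyu, e ▸ hyu⟩
  have ct := hS.apply_eq_apply_one (F := fun g => step f g t) fun s hs g =>
    hf.step_mul_of_not_isPendant hS g hs ht hpt
  have cu := hS.apply_eq_apply_one (F := fun g => step f g u) fun s hs g =>
    hf.step_mul_of_not_isPendant hS g hs hu hpu
  obtain ⟨i, -, hi⟩ := ((hS.isCycle t ht).sameCycle (Perm.mem_support.1 hyt)
    (Perm.mem_support.1 hxt)).exists_pow_eq'
  have powt : ∀ (r : Perm α) (p : α), p ∉ r.support → (r ^ i) p = p := fun r p hpr =>
    Perm.notMem_support.1 fun hm => hpr (Perm.support_pow_le r i hm)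
  set v := t ^ i * u * (t ^ i)⁻¹ with hv
  have hd : ¬ Meets (s * t * s⁻¹) v := by
    rintro ⟨p, hps, hp⟩
    rw [mem_support_conj] at hps hp
    by_cases hb : (t ^ i)⁻¹ p ∈ t.support
    · have e := hS.point_unique hu ht hut hp hb hyu hyt
      rw [Perm.inv_eq_iff_eq, hi] at e
      subst e
      have e := hS.point_unique hs ht hst (inv_apply_mem_support.2 hxs) hps hxs hxt
      rw [Perm.inv_eq_iff_eq] at e
      exact Perm.mem_support.1 hxs e.symm
    · have e := powt t _ hb
      rw [show (t ^ i) ((t ^ i)⁻¹ p) = p by simp] at e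
      rw [← e] at hp hb
      have hps' : p ∉ s.support := fun hm => hus ⟨p, hp, hm⟩
      have e' : s⁻¹ p = p := by rwa [← Perm.notMem_support, Perm.support_inv]
      exact hb (e' ▸ hps)
  have hcomm := (not_meets_iff_disjoint.1 hd).commute.eq
  have ctp : ∀ g, step f g (t ^ i) = step f 1 (t ^ i) := fun g => by
    rw [step_pow_of_forall f ct, step_pow_of_forall f ct]
  have cv : ∀ g, step f g v = step f 1 t ^ i * step f 1 u * (step f 1 t ^ i)⁻¹ := fun g => by
    rw [hv, step_conj f ctp cu, step_pow_of_forall f ct]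
  have cv' : ∀ g, step f g v = step f 1 v := fun g => (cv g).trans (cv 1).symm
  have hrel : ∀ g, step f g s * step f 1 t * step f (g * s * t) s⁻¹ * step f 1 v *
      (step f (g * s * t * s⁻¹ * v) s * (step f 1 t)⁻¹ *
        step f (g * s * t * s⁻¹ * v * s * t⁻¹) s⁻¹) = step f 1 v := by
    intro g
    have h₁ : s * t * s⁻¹ * v * (s * t⁻¹ * s⁻¹) = v := by
      rw [hcomm]
      simp [mul_assoc]
    have e := congrArg (step f g) h₁
    simp only [← step_mul, ← mul_assoc] at e
    simpa only [← mul_assoc, cv', ct, step_inv_of_forall f ct] using e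
  have key : ∀ g, step f (g * s * t) s = step f g s := by
    intro g
    have mt := hf.step_mem (g := 1).2 ht
    have mu := hf.step_mem (g := 1).2 hu
    have ms := hf.step_mem (g := g).2 hs
    have es : (step f g s).support = (step f 1 s).support := hf.support_step_eq hS g 1 hs
    obtain ⟨x', hxs', hxt'⟩ := (hf.meets_step_iff hS 1 hs ht).2 ⟨x, hxs, hxt⟩
    obtain ⟨y', hyu', hyt'⟩ := (hf.meets_step_iff hS 1 hu ht).2 ⟨y, hyu, hyt⟩
    have hus' := _root_.mt (hf.meets_step_iff hS 1 hu hs).1 hus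
    have hut' := _root_.mt (hf.support_step_eq_iff hS 1 hu ht).1 hut
    have hst' := _root_.mt (hf.support_step_eq_iff hS 1 hs ht).1 hst
    set τ := step f 1 t
    set υ := step f 1 u
    have hq : υ⁻¹ y' ∈ υ.support := inv_apply_mem_support.2 hyu'
    have hqt : υ⁻¹ y' ∉ τ.support := by
      intro hm
      have e := hS.point_unique mu mt hut' hq hm hyu' hyt'
      rw [Perm.inv_eq_iff_eq] at e
      exact Perm.mem_support.1 hyu' e.symm
    have hqs : υ⁻¹ y' ∉ (step f 1 s).support := fun hm => hus' ⟨_, hq, hm⟩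
    have hvq : step f 1 v (υ⁻¹ y') = (τ ^ i) y' := by
      have e : (τ ^ i)⁻¹ (υ⁻¹ y') = υ⁻¹ y' := by
        rw [Perm.inv_eq_iff_eq, powt τ _ hqt]
      rw [cv, Perm.mul_apply, Perm.mul_apply, e]
      simp
    have hz : (τ ^ i) y' ∈ τ.support := Perm.pow_apply_mem_support.2 hyt'
    -- The point `υ⁻¹ y'` avoids `τ` and the labels of `s`, so the last three factors fix it.
    have hfix : step f g s (τ (step f (g * s * t) s⁻¹ ((τ ^ i) y'))) = (τ ^ i) y' := by
      have e := congrArg (fun k : Perm α => k (υ⁻¹ y')) (hrel g)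
      have h₁ : step f (g * s * t * s⁻¹ * v * s * t⁻¹) s⁻¹ (υ⁻¹ y') = υ⁻¹ y' := by
        rwa [← Perm.notMem_support, hf.support_step_inv_eq hS _ 1 hs]
      have h₂ : τ⁻¹ (υ⁻¹ y') = υ⁻¹ y' := by
        rwa [← Perm.notMem_support, Perm.support_inv]
      have h₃ : step f (g * s * t * s⁻¹ * v) s (υ⁻¹ y') = υ⁻¹ y' := by
        rwa [← Perm.notMem_support, hf.support_step_eq hS _ 1 hs]
      simpa only [Perm.mul_apply, h₁, h₂, h₃, hvq] using e
    have e := apply_apply_eq_of_fixed ((hf.support_step_inv_eq hS _ g hs)) (es ▸ hxs')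
      (fun w hw hwt => hS.point_unique ms mt (es ▸ hst') hw hwt (es ▸ hxs') hxt') hz hfix
    rw [← Perm.eq_inv_iff_eq] at e
    rw [← inv_inj, ← hf.step_inv hS _ hs]
    exact hS.eq_of_apply_eq (hf.step_mem.2 (hS.inv_mem s hs)) (hS.inv_mem _ ms)
      (by rw [hf.support_step_inv_eq hS _ g hs, Perm.support_inv])
      (by rw [Perm.support_inv]; exact es ▸ hxs') e
  have h := key (g * s⁻¹)
  rw [inv_mul_cancel_right] at h
  have h' := hf.step_mul_self hS (g * s⁻¹) hs
  rw [inv_mul_cancel_right] at h'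
  rw [h, h']

theorem step_eq (g : Perm α) {t : Perm α} (ht : t ∈ S) : step f g t = step f 1 t := by
  refine hS.apply_eq_apply_one (F := fun g => step f g t) (fun s hs g => ?_) g
  by_cases hp : IsPendant S t
  · exact hf.step_mul_of_isPendant hS g ht hs hp
  · exact hf.step_mul_of_not_isPendant hS g hs ht hp

theorem map_mul (h1 : f 1 = 1) (g h : Perm α) : f (g * h) = f g * f h := by
  have hh : h ∈ Subgroup.closure S := hS.closure_eq ▸ Subgroup.mem_top h
  induction hh using Subgroup.closure_induction generalizing g with
  | mem s hs =>
    rw [← mul_step f g s, hf.step_eq hS g hs]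
    simp [step, h1]
  | one => simp [h1]
  | mul a b _ _ ha hb => rw [← mul_assoc, hb, ha, hb a, mul_assoc]
  | inv a _ ha =>
    have h₁ := ha (g * a⁻¹)
    have h₂ := ha a⁻¹
    rw [inv_mul_cancel_right] at h₁
    rw [inv_mul_cancel, h1] at h₂
    rw [h₁, mul_assoc, mul_eq_one_iff_eq_inv.1 h₂.symm, mul_inv_cancel, mul_one]

end PreservesSteps

end Rigidity

/-! ### Cycle graphs and acyclicity. -/

section Graphs

/-- Paths in `G₁` and `G₂` with the same ends coincide in `G`, so a first edge would belong to both
subgraphs. -/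
theorem eq_of_reachable_of_isAcyclic {V : Type*} {G G₁ G₂ : SimpleGraph V} (hG : G.IsAcyclic)
    (h₁ : G₁ ≤ G) (h₂ : G₂ ≤ G) (hd : ∀ a b, G₁.Adj a b → ¬ G₂.Adj a b) {x y : V}
    (hr₁ : G₁.Reachable x y) (hr₂ : G₂.Reachable x y) : x = y := by
  classical
  obtain ⟨p, hp⟩ := hr₁.exists_isPath
  obtain ⟨q, hq⟩ := hr₂.exists_isPath
  have e : p.mapLe h₁ = q.mapLe h₂ := congrArg Subtype.val
    ((hG.subsingleton_path x y).elim ⟨p.mapLe h₁, hp.mapLe h₁⟩ ⟨q.mapLe h₂, hq.mapLe h₂⟩)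
  have e' := congrArg SimpleGraph.Walk.edges e
  rw [SimpleGraph.Walk.edges_mapLe_eq_edges, SimpleGraph.Walk.edges_mapLe_eq_edges] at e'
  cases p with
  | nil => rfl
  | cons h p =>
    refine absurd ?_ (hd _ _ h)
    refine q.adj_of_mem_edges ?_
    rw [← e']
    simp

variable {n : ℕ} {T : Set (Perm (Fin n))} {start : Perm (Fin n) → Fin n}

theorem cycleGraph_mono {T' : Set (Perm (Fin n))} (h : T' ⊆ T) :
    cycleGraph T' start ≤ cycleGraph T start := by
  intro a b hab
  simp only [cycleGraph, SimpleGraph.fromRel_adj] at hab ⊢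
  refine ⟨hab.1, hab.2.imp ?_ ?_⟩ <;>
  · rintro ⟨t, ht, h'⟩
    exact ⟨t, h ht, h'⟩

theorem exists_mem_support_of_cycleGraph_adj {a b : Fin n} (h : (cycleGraph T start).Adj a b) :
    ∃ t ∈ T, a ∈ t.support ∧ b ∈ t.support := by
  simp only [cycleGraph, SimpleGraph.fromRel_adj] at h
  obtain ⟨-, ⟨t, ht, ha, rfl, -⟩ | ⟨t, ht, ha, rfl, -⟩⟩ := h
  · exact ⟨t, ht, ha, Perm.apply_mem_support.2 ha⟩
  · exact ⟨t, ht, Perm.apply_mem_support.2 ha, ha⟩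

theorem cycleGraph_reachable_start {t : Perm (Fin n)} (ht : t ∈ T) (hc : t.IsCycle)
    (hs : start t ∈ t.support) {x : Fin n} (hx : x ∈ t.support) :
    (cycleGraph T start).Reachable (start t) x := by
  obtain ⟨i, -, rfl⟩ :=
    (hc.sameCycle (Perm.mem_support.1 hs) (Perm.mem_support.1 hx)).exists_pow_eq'
  clear hx
  induction i with
  | zero => simp
  | succ i ih =>
    rw [pow_succ', Perm.mul_apply]
    have hi : (t ^ i) (start t) ∈ t.support := Perm.pow_apply_mem_support.2 hs
    by_cases he : t ((t ^ i) (start t)) = start t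
    · rw [he]
    · refine ih.trans (SimpleGraph.Adj.reachable ?_)
      rw [cycleGraph, SimpleGraph.fromRel_adj]
      exact ⟨(Perm.mem_support.1 hi).symm, Or.inl ⟨t, ht, hi, rfl, he⟩⟩

theorem cycleGraph_reachable {t : Perm (Fin n)} (ht : t ∈ T) (hc : t.IsCycle)
    (hs : start t ∈ t.support) {x y : Fin n} (hx : x ∈ t.support) (hy : y ∈ t.support) :
    (cycleGraph T start).Reachable x y :=
  (cycleGraph_reachable_start ht hc hs hx).symm.trans (cycleGraph_reachable_start ht hc hs hy)

theorem cycleGraph_reachable_of_mem_closure (hc : ∀ t ∈ T, t.IsCycle)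
    (hs : ∀ t ∈ T, start t ∈ t.support) {g : Perm (Fin n)} (hg : g ∈ Subgroup.closure T)
    (x : Fin n) : (cycleGraph T start).Reachable x (g x) := by
  induction hg using Subgroup.closure_induction generalizing x with
  | mem t ht =>
    by_cases hx : x ∈ t.support
    · exact cycleGraph_reachable ht (hc t ht) (hs t ht) hx (Perm.apply_mem_support.2 hx)
    · rw [Perm.notMem_support.1 hx]
  | one => simp
  | mul a b _ _ ha hb => exact (hb x).trans (ha (b x))
  | inv a _ ha => simpa using (ha (a⁻¹ x)).symm

end Graphs

/-! ### Normal sets give split systems. -/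

section NormalSets

variable {n k : ℕ} {T : Set (Perm (Fin n))}

theorem exists_mem_of_mem_union_inv {s : Perm (Fin n)} (hs : s ∈ T ∪ T⁻¹) :
    ∃ t ∈ T, t.support = s.support ∧ (s = t ∨ s = t⁻¹) := by
  rcases hs with hs | hs
  · exact ⟨s, hs, rfl, Or.inl rfl⟩
  · exact ⟨s⁻¹, hs, Perm.support_inv s, Or.inr (inv_inv s).symm⟩

namespace IsNormalSet

variable (hT : IsNormalSet k T)

include hT

theorem eq_of_mem_support {s t : Perm (Fin n)} (hs : s ∈ T) (ht : t ∈ T) {x y : Fin n}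
    (hxy : x ≠ y) (hxs : x ∈ s.support) (hxt : x ∈ t.support) (hys : y ∈ s.support)
    (hyt : y ∈ t.support) : s = t := by
  by_contra hst
  exact hxy (Finset.card_le_one.1 (hT.split s hs t ht hst) x (Finset.mem_inter.2 ⟨hxs, hxt⟩) y
    (Finset.mem_inter.2 ⟨hys, hyt⟩))

theorem eq_of_support_eq {s t : Perm (Fin n)} (hs : s ∈ T) (ht : t ∈ T)
    (hst : s.support = t.support) : s = t := by
  obtain ⟨x, hx, -⟩ := hT.isCycle s hs
  rw [← Perm.mem_support] at hx
  have hy := Perm.apply_mem_support.2 hx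
  exact hT.eq_of_mem_support hs ht (Perm.mem_support.1 hx).symm hx (hst ▸ hx) hy (hst ▸ hy)

theorem isCycle_of_mem_union {s : Perm (Fin n)} (hs : s ∈ T ∪ T⁻¹) : s.IsCycle := by
  obtain ⟨t, ht, -, rfl | rfl⟩ := exists_mem_of_mem_union_inv hs
  · exact hT.isCycle _ ht
  · exact (hT.isCycle _ ht).inv

theorem isLeaf_of_isPendant {l t : Perm (Fin n)} (hl : l ∈ T) (ht : t ∈ T) (hlt : t ≠ l)
    (hm : Meets t l) (hp : IsPendant (T ∪ T⁻¹) l) : IsLeaf T l := by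
  refine ⟨hl, ?_⟩
  obtain ⟨x, hx⟩ := hp
  obtain ⟨y, hyt, hyl⟩ := hm
  rw [degree, Set.ncard_eq_one]
  refine ⟨y, ?_⟩
  have hyx := hx t (Or.inl ht) (fun e => hlt (hT.eq_of_support_eq ht hl e)) y hyt hyl
  ext z
  simp only [Set.mem_ofPred_eq, Set.mem_singleton_iff]
  constructor
  · rintro ⟨hzl, s, hs, hsl, hzs⟩
    rw [hyx]
    exact hx s (Or.inl hs) (fun e => hsl (hT.eq_of_support_eq hs hl e)) z hzs hzl
  · rintro rfl
    exact ⟨hyl, t, ht, hlt, hyt⟩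

/-- `x` and `g x` are joined in the cycle graph of `T \ {t}` and in that of `{t}`; splitness makes
these edge-disjoint subgraphs of the tree. -/
theorem apply_eq_of_mem_closure {t : Perm (Fin n)} (ht : t ∈ T) {g : Perm (Fin n)}
    (hg : g ∈ Subgroup.closure (T \ {t})) {x : Fin n} (hx : x ∈ t.support)
    (hgx : g x ∈ t.support) : g x = x := by
  obtain ⟨start, hs, htree⟩ := hT.tree
  have h₁ := cycleGraph_reachable_of_mem_closure (start := start)
    (fun s hs' => hT.isCycle s hs'.1) (fun s hs' => hs s hs'.1) hg x
  have h₂ := cycleGraph_reachable (T := {t}) (Set.mem_singleton t) (hT.isCycle t ht) (hs t ht) hx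
    hgx
  refine (eq_of_reachable_of_isAcyclic htree.isAcyclic (cycleGraph_mono Set.sdiff_subset)
    (cycleGraph_mono (Set.singleton_subset_iff.2 ht)) ?_ h₁ h₂).symm
  intro a b hab hab'
  obtain ⟨s, hs, has, hbs⟩ := exists_mem_support_of_cycleGraph_adj hab
  obtain ⟨t', rfl, hat, hbt⟩ := exists_mem_support_of_cycleGraph_adj hab'
  exact hs.2 (hT.eq_of_mem_support hs.1 ht hab.ne has hat hbs hbt)

theorem splitSystem : SplitSystem (T ∪ T⁻¹) where
  inv_mem s hs := by
    rcases hs with hs | hs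
    · exact Or.inr (by simpa using hs)
    · exact Or.inl hs
  isCycle s hs := hT.isCycle_of_mem_union hs
  eq_or_eq_inv s hs t ht hst := by
    obtain ⟨s', hs', es, h⟩ := exists_mem_of_mem_union_inv hs
    obtain ⟨t', ht', et, h'⟩ := exists_mem_of_mem_union_inv ht
    obtain rfl := hT.eq_of_support_eq hs' ht' (es.trans (hst.trans et.symm))
    rcases h with rfl | rfl <;> rcases h' with rfl | rfl <;> simp
  separated t ht g hg x hx hgx := by
    obtain ⟨t', ht', et, -⟩ := exists_mem_of_mem_union_inv ht
    rw [← et] at hx hgx hg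
    refine hT.apply_eq_of_mem_closure ht' ?_ hx hgx
    refine (Subgroup.closure_le _).2 ?_ hg
    rintro s ⟨hs, hst⟩
    obtain ⟨s', hs', es, h⟩ := exists_mem_of_mem_union_inv hs
    have hmem : s' ∈ Subgroup.closure (T \ {t'}) := by
      refine Subgroup.subset_closure ⟨hs', ?_⟩
      rintro rfl
      exact hst es.symm
    rcases h with rfl | rfl
    · exact hmem
    · exact Subgroup.inv_mem _ hmem
  mul_self s hs t ht h := by
    obtain ⟨s', hs', es, -⟩ := exists_mem_of_mem_union_inv hs
    obtain ⟨t', ht', et, -⟩ := exists_mem_of_mem_union_inv ht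
    have ho : orderOf t = orderOf s := by
      rw [(hT.isCycle_of_mem_union hs).orderOf, (hT.isCycle_of_mem_union ht).orderOf, ← es, ← et,
        hT.length_eq s' hs', hT.length_eq t' ht']
    rw [← sq, ← orderOf_dvd_iff_pow_eq_one] at h ⊢
    rwa [ho]
  closure_eq := top_le_iff.1 (hT.generates ▸ Subgroup.closure_mono Set.subset_union_left)
  exists_third s hs t ht := by
    obtain ⟨s', hs', es, -⟩ := exists_mem_of_mem_union_inv hs
    obtain ⟨t', ht', et, -⟩ := exists_mem_of_mem_union_inv ht
    have hcard : ({s', t'} : Set (Perm (Fin n))).ncard < T.ncard :=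
      ((Set.ncard_insert_le s' {t'}).trans_eq (by rw [Set.ncard_singleton])).trans_lt hT.two_lt
    obtain ⟨u, hu, hu'⟩ := Set.exists_mem_notMem_of_ncard_lt_ncard hcard
    simp only [Set.mem_insert_iff, Set.mem_singleton_iff, not_or] at hu'
    refine ⟨u, Or.inl hu, fun e => hu'.1 ?_, fun e => hu'.2 ?_⟩
    · exact hT.eq_of_support_eq hu hs' (e.trans es.symm)
    · exact hT.eq_of_support_eq hu ht' (e.trans et.symm)
  pendant_unique t ht l₁ hl₁ l₂ hl₂ hp₁ hp₂ h₁ h₂ hm₁ hm₂ := by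
    obtain ⟨t', ht', et, -⟩ := exists_mem_of_mem_union_inv ht
    have key : ∀ l ∈ T ∪ T⁻¹, IsPendant (T ∪ T⁻¹) l → t.support ≠ l.support → Meets t l →
        ∃ l' : Perm (Fin n), IsLeaf T l' ∧ Adjacent t' l' ∧ l'.support = l.support := by
      intro l hl hp h hm
      obtain ⟨l', hl', el, -⟩ := exists_mem_of_mem_union_inv hl
      have hne : t' ≠ l' := by
        rintro rfl
        exact h (et.symm.trans el)
      have hm' : Meets t' l' := by
        rw [Meets, et, el]
        exact hm
      have hp' : IsPendant (T ∪ T⁻¹) l' := by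
        rw [IsPendant, el]
        exact hp
      refine ⟨l', hT.isLeaf_of_isPendant hl' ht' hne hm' hp', ⟨hne, ?_⟩, el⟩
      obtain ⟨x, hx, hx'⟩ := hm'
      exact ⟨x, Finset.mem_inter.2 ⟨hx, hx'⟩⟩
    obtain ⟨l₁', hl₁', ha₁, e₁⟩ := key l₁ hl₁ hp₁ h₁ hm₁
    obtain ⟨l₂', hl₂', ha₂, e₂⟩ := key l₂ hl₂ hp₂ h₂ hm₂
    rw [← e₁, ← e₂, hT.leaf_unique t' ht' l₁' l₂' hl₁' hl₂' ha₁ ha₂]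

end IsNormalSet

end NormalSets

/-! ### The semidirect product acting on a Cayley graph. -/

section NormalCayleyGraphs

variable {G : Type*} [Group G]

theorem mulCayley_adj_iff_mem_union (S : Set G) (u v : G) :
    (SimpleGraph.mulCayley S).Adj u v ↔ u ≠ v ∧ u⁻¹ * v ∈ S ∪ S⁻¹ := by
  rw [SimpleGraph.mulCayley_adj, Set.mem_union, Set.mem_inv, mul_inv_rev, inv_inv]

theorem mem_iff_of_mem_autPreserving {A : Set G} {φ : MulAut G} (hφ : φ ∈ autPreserving A)
    (x : G) : φ x ∈ A ↔ x ∈ A := by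
  have h : φ '' A = A := hφ
  conv_lhs => rw [← h]
  exact φ.injective.mem_set_image

/-- A group automorphism that preserves `S ∪ S⁻¹`, as an automorphism of the Cayley graph. -/
def autToGraph (S : Set G) :
    autPreserving (S ∪ S⁻¹) →* (SimpleGraph.mulCayley S ≃g SimpleGraph.mulCayley S) where
  toFun φ :=
    { toEquiv := (φ : MulAut G).toEquiv
      map_rel_iff' := by
        intro a b
        rw [mulCayley_adj_iff_mem_union, mulCayley_adj_iff_mem_union]
        refine and_congr (φ : MulAut G).injective.ne_iff ?_
        rw [← mem_iff_of_mem_autPreserving φ.2 (a⁻¹ * b), map_mul, map_inv]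
        rfl }
  map_one' := rfl
  map_mul' _ _ := rfl

/-- The homomorphism from `R(G) ⋊ Aut(G, S ∪ S⁻¹)` to the automorphism group of the Cayley
graph. -/
noncomputable def semidirectToGraph (S : Set G) :
    regularSubgroup S ⋊[actionOnRegular S (autPreserving (S ∪ S⁻¹))] autPreserving (S ∪ S⁻¹) →*
      (SimpleGraph.mulCayley S ≃g SimpleGraph.mulCayley S) :=
  SemidirectProduct.lift (regularSubgroup S).subtype (autToGraph S) <| by
    intro φ
    ext r x
    obtain ⟨g, rfl⟩ := (regularEquiv S).surjective r
    change (regularEquiv S ((φ : MulAut G) ((regularEquiv S).symm (regularEquiv S g)))).1 x =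
      (φ : MulAut G) (g * (φ : MulAut G).symm x)
    rw [MulEquiv.symm_apply_apply, map_mul, MulEquiv.apply_symm_apply]
    rfl

theorem semidirectToGraph_apply (S : Set G)
    (a : regularSubgroup S ⋊[actionOnRegular S (autPreserving (S ∪ S⁻¹))]
      autPreserving (S ∪ S⁻¹)) (x : G) :
    semidirectToGraph S a x = a.left.1 ((a.right : MulAut G) x) :=
  rfl

theorem semidirectToGraph_injective (S : Set G) : Function.Injective (semidirectToGraph S) := by
  rw [injective_iff_map_eq_one]
  intro a ha
  have h : ∀ x, a.left.1 ((a.right : MulAut G) x) = x := fun x => by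
    rw [← semidirectToGraph_apply, ha]
    rfl
  have hl : a.left = 1 := by
    obtain ⟨g, hg⟩ := (regularEquiv S).surjective a.left
    have h1 := h 1
    rw [map_one, ← hg] at h1
    have hg1 : g * 1 = 1 := h1
    rw [mul_one] at hg1
    rw [← hg, hg1, map_one]
  refine SemidirectProduct.ext hl (Subtype.ext (MulEquiv.ext fun x => ?_))
  have hx := h x
  rwa [hl] at hx

theorem semidirectToGraph_surjective (S : Set G)
    (h : ∀ f : SimpleGraph.mulCayley S ≃g SimpleGraph.mulCayley S, f 1 = 1 →
      ∀ x y, f (x * y) = f x * f y) : Function.Surjective (semidirectToGraph S) := by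
  intro f
  set f' := (translation S (f 1))⁻¹ * f with hf'
  have h1 : f' 1 = 1 := inv_mul_cancel (f 1)
  let φ : MulAut G := MulEquiv.mk' f'.toEquiv (h f' h1)
  have hφ : φ ∈ autPreserving (S ∪ S⁻¹) := by
    have key : ∀ x, φ x ∈ S ∪ S⁻¹ ↔ x ∈ S ∪ S⁻¹ := by
      intro x
      -- The graph has no loops, so adjacency to `1` decides membership only for `x ≠ 1`.
      by_cases hx : x = 1
      · rw [hx, map_one]
      · have hadj : (SimpleGraph.mulCayley S).Adj (f' 1) (f' x) ↔
            (SimpleGraph.mulCayley S).Adj 1 x := f'.map_rel_iff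
        rw [mulCayley_adj_iff_mem_union, mulCayley_adj_iff_mem_union, h1, inv_one, one_mul,
          one_mul] at hadj
        have hx' : (1 : G) ≠ f' x := fun e => hx (f'.injective (h1.trans e)).symm
        exact (and_iff_right hx').symm.trans (hadj.trans (and_iff_right (Ne.symm hx)))
    change φ '' (S ∪ S⁻¹) = S ∪ S⁻¹
    ext y
    obtain ⟨x, rfl⟩ := φ.surjective y
    rw [φ.injective.mem_set_image, key]
  refine ⟨⟨regularEquiv S (f 1), ⟨φ, hφ⟩⟩, RelIso.ext fun x => ?_⟩
  change f 1 * ((f 1)⁻¹ * f x) = f x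
  rw [mul_inv_cancel_left]

end NormalCayleyGraphs

theorem IsNormalSet.map_mul {n k : ℕ} {T : Set (Perm (Fin n))} (hT : IsNormalSet k T)
    (f : SimpleGraph.mulCayley T ≃g SimpleGraph.mulCayley T) (h1 : f 1 = 1)
    (x y : Perm (Fin n)) : f (x * y) = f x * f y := by
  have hone : (1 : Perm (Fin n)) ∉ T ∪ T⁻¹ := fun h => (hT.isCycle_of_mem_union h).ne_one rfl
  have hadj : ∀ u v : Perm (Fin n),
      (SimpleGraph.mulCayley T).Adj u v ↔ u⁻¹ * v ∈ T ∪ T⁻¹ := by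
    intro u v
    rw [mulCayley_adj_iff_mem_union, and_iff_right_iff_imp]
    rintro h rfl
    rw [inv_mul_cancel] at h
    exact hone h
  have hf : PreservesSteps (T ∪ T⁻¹) f.toEquiv := by
    intro u v
    rw [← hadj, ← hadj]
    exact f.map_rel_iff
  exact hf.map_mul hT.splitSystem h1 x y

end SplitCycles

theorem mainTheorem2 (n k : ℕ) (T : Set (Equiv.Perm (Fin n)))
    (hT : SplitCycles.IsNormalSet k T) :
    ∃ f : SplitCycles.regularSubgroup T
          ⋊[SplitCycles.actionOnRegular T (SplitCycles.autPreserving (T ∪ T⁻¹))]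
          SplitCycles.autPreserving (T ∪ T⁻¹) ≃*
        (SimpleGraph.mulCayley T ≃g SimpleGraph.mulCayley T),
      (∀ r : SplitCycles.regularSubgroup T,
        f (SemidirectProduct.inl r) =
          (r : SimpleGraph.mulCayley T ≃g SimpleGraph.mulCayley T)) ∧
      (∀ (φ : SplitCycles.autPreserving (T ∪ T⁻¹)) (x : Equiv.Perm (Fin n)),
        f (SemidirectProduct.inr φ) x = (φ : MulAut (Equiv.Perm (Fin n))) x) := by
  refine ⟨MulEquiv.ofBijective (SplitCycles.semidirectToGraph T)
    ⟨SplitCycles.semidirectToGraph_injective T,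
      SplitCycles.semidirectToGraph_surjective T hT.map_mul⟩, fun r => RelIso.ext fun x => rfl, fun φ x => rfl⟩
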